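/- **Nyström approximation with kernel $k$-means++ landmarks: expected error bound.** Let $y_1,\dots,y_N\in\mathbb R^d$, let $k$ be a natural number, and let $H=H^{(k)}\in\mathbb R^{N\times N}$, $H_{n,n'}=\langle y_n,y_{n'}\rangle^k$, be the Gram matrix of the degree-$k$ homogeneous polynomial kernel, with feature vectors $\psi_n=y_n^{\otimes k}$. Let $\lambda_1\ge\dots\ge\lambda_N$ be the eigenvalues of $H$ with orthonormal eigenvectors $u_1,\dots,u_N$. For $1\le m\le N$ let $H_m$ be an optimal rank-$m$ approximation of $H$ in Frobenius norm, and let $U_m=\operatorname{span}\{\sum_n u_i(n)\psi_n : i\le m\}$ be the subspace of the feature space spanned by the top $m$ eigenvectors. The potential of a clustering of points is the sum of the squared distances of the points to the centroids of their clusters. Let $\ell\in\{m,m+1\}$, let $C^*$ be an optimal $\ell$-clustering of $\psi_1,\dots,\psi_N$ (one of minimal potential), let $\phi(C^*\mid U_m)$ be the potential of $C^*$ after all $\psi_n$ are projected orthogonally onto $U_m$, and assume the clustering-potential condition $$\phi(C^*\mid U_m)\le\sqrt{N-m}\,\|H-H_m\|_F .$$ Let $\widetilde H$ be the Nyström approximation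 $H_{:,Z}\,(H_{Z,Z})^{+}H_{Z,:}$, where the list $Z$ of $\ell$ landmark indices is drawn by kernel $k$-means++ sampling: the first index is uniform, and each further index $n$ has probability proportional to the squared distance of $\psi_n$ to the nearest feature vector drawn so far (uniform if all these distances vanish). Expectations are over the choice of landmarks. 1. For all $a>1$ and $C>0$ there is a constant $K$, depending only on $a$ and $C$, such that the following holds for all such data. If, for some $i_0$, $\lambda_i\le C\,i^{-a}$ for all $i_0\le i\le N$, then for every $m$ with $\max(2,i_0)\le m\le N$ that satisfies the condition above, $$\mathbb E\,\|H-\widetilde H\|_F\le K\,\ln(m)\,\sqrt{N-m}\;m^{-a+1/2}.$$ 2. Without any decay assumption: if the condition above holds for $m=\operatorname{rank}H\ge1$, then $\mathbb E\,\|H-\widetilde H\|_F=0$ (the expected error vanishes once $m$ reaches $\operatorname{rank}H$). -/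

import Mathlib

open scoped ENNReal

noncomputable section

namespace KernelNystrom

/-- The Gram matrix of the homogeneous polynomial kernel `⟨y, y'⟩ ^ k` on the points `y`. -/
def gram {d N : ℕ} (k : ℕ) (y : Fin N → EuclideanSpace ℝ (Fin d)) : Matrix (Fin N) (Fin N) ℝ :=
  Matrix.of fun n n' => (inner ℝ (y n) (y n')) ^ k

theorem gram_isHermitian {d N : ℕ} (k : ℕ) (y : Fin N → EuclideanSpace ℝ (Fin d)) :
    (gram k y).IsHermitian := by
  ext i j
  simp [gram, real_inner_comm]

/-- The feature map of the homogeneous polynomial kernel of degree `k`: the coordinates of the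
`k`-fold tensor power of `y`. -/
def feature {d : ℕ} (k : ℕ) (y : EuclideanSpace ℝ (Fin d)) :
    EuclideanSpace ℝ (Fin k → Fin d) :=
  WithLp.toLp 2 fun s => ∏ t, y (s t)

theorem inner_feature {d : ℕ} (k : ℕ) (y y' : EuclideanSpace ℝ (Fin d)) :
    inner ℝ (feature k y) (feature k y') = (inner ℝ y y') ^ k := by
  simp only [feature, PiLp.inner_apply, RCLike.inner_apply, conj_trivial]
  simp_rw [← Finset.prod_mul_distrib]
  exact (Fintype.sum_pow (fun j => y' j * y j) k).symm

/-- The Frobenius norm. -/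
def frobNorm {N : ℕ} (A : Matrix (Fin N) (Fin N) ℝ) : ℝ :=
  √(∑ i, ∑ j, A i j ^ 2)

/-- `B` is an optimal rank-`m` approximation of `A` in Frobenius norm. -/
def IsOptimalRankApprox {N : ℕ} (A : Matrix (Fin N) (Fin N) ℝ) (m : ℕ)
    (B : Matrix (Fin N) (Fin N) ℝ) : Prop :=
  B.rank ≤ m ∧ ∀ B' : Matrix (Fin N) (Fin N) ℝ, B'.rank ≤ m → frobNorm (A - B) ≤ frobNorm (A - B')

/-- `lam 0 ≥ lam 1 ≥ …` are the eigenvalues of `A` with multiplicity, in decreasing order, and `u`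
is an orthonormal basis of corresponding eigenvectors. -/
def IsSpectralDecomposition {N : ℕ} (A : Matrix (Fin N) (Fin N) ℝ) (lam : Fin N → ℝ)
    (u : OrthonormalBasis (Fin N) ℝ (EuclideanSpace ℝ (Fin N))) : Prop :=
  Antitone lam ∧ ∀ i, A.mulVec (u i).ofLp = lam i • (u i).ofLp

/-- The subspace of the feature space that is spanned by the first `m` eigenvectors `u` of the Gram
matrix of the points `x`: the eigenvector `u i` stands for the vector `∑ n, u i n • x n`. -/
def topSubspace {N : ℕ} {E : Type*} [NormedAddCommGroup E] [InnerProductSpace ℝ E]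
    (x : Fin N → E) (u : OrthonormalBasis (Fin N) ℝ (EuclideanSpace ℝ (Fin N))) (m : ℕ) :
    Submodule ℝ E :=
  Submodule.span ℝ {v | ∃ i : Fin N, (i : ℕ) < m ∧ v = ∑ n, u i n • x n}

/-- The centroid of the `j`-th cluster; a clustering of `N` points into `l` clusters is a map
`c : Fin N → Fin l`. -/
def centroid {N l : ℕ} {E : Type*} [NormedAddCommGroup E] [InnerProductSpace ℝ E]
    (x : Fin N → E) (c : Fin N → Fin l) (j : Fin l) : E :=
  ((Finset.univ.filter fun n => c n = j).card : ℝ)⁻¹ •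
    ∑ n ∈ Finset.univ.filter (fun n => c n = j), x n

/-- The clustering potential: the sum of the squared distances of the points to the centroids of
their clusters. -/
def potential {N l : ℕ} {E : Type*} [NormedAddCommGroup E] [InnerProductSpace ℝ E]
    (x : Fin N → E) (c : Fin N → Fin l) : ℝ :=
  ∑ n, ‖x n - centroid x c (c n)‖ ^ 2

/-- `c` is an optimal `l`-clustering of the points `x`. -/
def IsOptimalClustering {N l : ℕ} {E : Type*} [NormedAddCommGroup E] [InnerProductSpace ℝ E]
    (x : Fin N → E) (c : Fin N → Fin l) : Prop :=
  ∀ c' : Fin N → Fin l, potential x c ≤ potential x c'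

/-- The clustering potential of the clustering `c` after the points are projected orthogonally
onto the finite-dimensional subspace `U`. -/
def projectedPotential {N l : ℕ} {E : Type*} [NormedAddCommGroup E] [InnerProductSpace ℝ E]
    [FiniteDimensional ℝ E] (x : Fin N → E) (c : Fin N → Fin l) (U : Submodule ℝ E) : ℝ :=
  potential (fun n => U.starProjection (x n)) c

/-- The squared distance of `x n` to the nearest of the landmarks `x (z j)`. -/
def sqDist {N l : ℕ} {E : Type*} [NormedAddCommGroup E]
    (x : Fin N → E) (z : Fin l → Fin N) (n : Fin N) : ℝ≥0∞ :=
  ⨅ j, edist (x n) (x (z j)) ^ 2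

theorem tsum_sqDist_ne_top {N l : ℕ} {E : Type*} [NormedAddCommGroup E]
    (x : Fin N → E) (z : Fin l → Fin N) (hl : l ≠ 0) : ∑' n, sqDist x z n ≠ ∞ := by
  rw [tsum_fintype]
  refine ENNReal.sum_ne_top.2 fun n _ => ne_top_of_le_ne_top ?_ (iInf_le _ ⟨0, by omega⟩)
  exact ENNReal.pow_ne_top (edist_ne_top _ _)

open Classical in
/-- The law of the next landmark in k-means++ sampling, given the landmarks `z`: the index `n` has
probability proportional to the squared distance of `x n` to the nearest landmark. The first
landmark is uniform; so is a landmark that is drawn when every point already coincides with a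
landmark (no squared distance is then positive, and the choice has no effect on spans). -/
def nextLandmark {N l : ℕ} [NeZero N] {E : Type*} [NormedAddCommGroup E]
    (x : Fin N → E) (z : Fin l → Fin N) : PMF (Fin N) :=
  if h : l = 0 ∨ ∑' n, sqDist x z n = 0 then PMF.uniformOfFintype (Fin N)
  else PMF.normalize (sqDist x z) (fun h0 => h (Or.inr h0))
    (tsum_sqDist_ne_top x z fun h0 => h (Or.inl h0))

/-- The law of `l` landmarks drawn by k-means++ sampling from the points `x`. -/
def landmarks {N : ℕ} [NeZero N] {E : Type*} [NormedAddCommGroup E] (x : Fin N → E) :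
    (l : ℕ) → PMF (Fin l → Fin N)
  | 0 => PMF.pure Fin.elim0
  | l + 1 => (landmarks x l).bind fun z =>
      (nextLandmark x z).map fun n => (Fin.snoc z n : Fin (l + 1) → Fin N)

/-- The Moore–Penrose inverse of a symmetric matrix. -/
def pinv {l : ℕ} {A : Matrix (Fin l) (Fin l) ℝ} (hA : A.IsHermitian) :
    Matrix (Fin l) (Fin l) ℝ :=
  (hA.eigenvectorUnitary : Matrix (Fin l) (Fin l) ℝ) *
    Matrix.diagonal (fun i => (hA.eigenvalues i)⁻¹) *
    star (hA.eigenvectorUnitary : Matrix (Fin l) (Fin l) ℝ)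

/-- The Nyström approximation `C W⁺ Cᵀ` of `A` with landmarks `z`, where `C` holds the columns of `A`
at the landmarks and `W` the rows and columns of `A` at the landmarks. -/
def nystrom {N l : ℕ} {A : Matrix (Fin N) (Fin N) ℝ} (hA : A.IsHermitian) (z : Fin l → Fin N) :
    Matrix (Fin N) (Fin N) ℝ :=
  A.submatrix id z * pinv (hA.submatrix z) * (A.submatrix id z).transpose

/-- The expected Frobenius error of the Nyström approximation of the Gram matrix of the polynomial
kernel of degree `k` on the points `y`, with `l` landmarks drawn by kernel k-means++ sampling. -/
def expectedError {d N : ℕ} [NeZero N] (k : ℕ) (y : Fin N → EuclideanSpace ℝ (Fin d)) (l : ℕ) : ℝ :=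
  ∑ z : Fin l → Fin N, (landmarks (fun n => feature k (y n)) l z).toReal *
    frobNorm (gram k y - nystrom (gram_isHermitian k y) z)

/-- The clustering-potential condition `φ(C* | U_m) ≤ √(N - m) ‖H - H_m‖_F`, where `H` is the Gram
matrix of the polynomial kernel of degree `k` on the points `y`, `H_m` is an optimal rank-`m`
approximation of `H`, `U_m` is the span in feature space of the first `m` of the eigenvectors `u`
of `H`, and `C*` is the clustering `c` of the feature vectors. -/
def PotentialCondition {d N l : ℕ} (k : ℕ) (y : Fin N → EuclideanSpace ℝ (Fin d)) (m : ℕ)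
    (Hm : Matrix (Fin N) (Fin N) ℝ)
    (u : OrthonormalBasis (Fin N) ℝ (EuclideanSpace ℝ (Fin N))) (c : Fin N → Fin l) : Prop :=
  projectedPotential (fun n => feature k (y n)) c (topSubspace (fun n => feature k (y n)) u m) ≤
    √((N : ℝ) - m) * frobNorm (gram k y - Hm)

end KernelNystrom

end

/-!
The Nyström error `H - H̃` is the Gram matrix of the residuals of the feature vectors modulo the
span of the landmarks (`inner_residual_residual`). Its Frobenius norm is at most its trace, and each
residual is no longer than the distance to any landmark, so the error is bounded by the sum of the
squared distances of the feature vectors to their nearest landmarks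
(`frobNorm_sub_nystrom_le`).

The expectation of this sum under k-means++ sampling is at most `8 (1 + H_{l-1})` times the potential
of any `l`-clustering, where `H_t` is the harmonic number (`expect_sum_landmarkDist_le`, the theorem
of Arthur and Vassilvitskii). The proof exhibits a function of the current landmarks and the number
`t` of draws still to come, `valueBound`, that does not increase in expectation in a sampling step
(`expect_nextLandmark_valueBound_le`): it charges each cluster without a landmark eight times its
cost about its centroid, which bounds the expected cost after a landmark has been drawn from it
(`sum_landmarkDist_mul_landmarkCost_snoc_le`), multiplies all charges by `1 + H_t`, and adds the
fraction `(u - t) / u` of the cost of the `u` clusters without a landmark, at least `u - t` of which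
stay without one. After the last draw it dominates the sum of squared distances.

The potential of the given clustering splits along `U_m` and its orthogonal complement. The first
part is bounded by the clustering-potential condition, where `‖H - H_m‖_F` is at most the error
`(∑_{i > m} λ_i²)^{1/2}` of the truncated spectral decomposition. The second is at most the tail
`∑_{i > m} λ_i`, and by Cauchy-Schwarz both are at most `√(N - m) (∑_{i > m} λ_i²)^{1/2}`
(`PotentialCondition.potential_le`). Polynomial decay bounds the last sum by an integral, and for
`m = rank H` it vanishes, since the eigenvalues are nonnegative and decreasing.
-/

namespace KernelNystrom

/-! ### Clusters and their costs -/

section Clustering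

variable {N l : ℕ} {E : Type*} [NormedAddCommGroup E] [InnerProductSpace ℝ E]

/-- The indices of the points in the `j`-th cluster. -/
noncomputable def cluster (c : Fin N → Fin l) (j : Fin l) : Finset (Fin N) :=
  Finset.univ.filter fun n => c n = j

/-- The share of the `j`-th cluster in the clustering potential. -/
noncomputable def clusterCost (x : Fin N → E) (c : Fin N → Fin l) (j : Fin l) : ℝ :=
  ∑ n ∈ cluster c j, ‖x n - centroid x c j‖ ^ 2

theorem mem_cluster {c : Fin N → Fin l} {j : Fin l} {n : Fin N} :
    n ∈ cluster c j ↔ c n = j := by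
  simp [cluster]

theorem sum_cluster {M : Type*} [AddCommMonoid M] (c : Fin N → Fin l) (f : Fin N → M) :
    ∑ j, ∑ n ∈ cluster c j, f n = ∑ n, f n :=
  Finset.sum_fiberwise _ _ _

theorem clusterCost_nonneg (x : Fin N → E) (c : Fin N → Fin l) (j : Fin l) :
    0 ≤ clusterCost x c j :=
  Finset.sum_nonneg fun _ _ => sq_nonneg _

theorem sum_clusterCost (x : Fin N → E) (c : Fin N → Fin l) :
    ∑ j, clusterCost x c j = potential x c := by
  rw [potential, ← sum_cluster c]
  refine Finset.sum_congr rfl fun j _ => Finset.sum_congr rfl fun n hn => ?_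
  rw [mem_cluster.1 hn]

theorem sum_sub_centroid (x : Fin N → E) (c : Fin N → Fin l) (j : Fin l) :
    ∑ n ∈ cluster c j, (x n - centroid x c j) = 0 := by
  rw [Finset.sum_sub_distrib, Finset.sum_const, ← Nat.cast_smul_eq_nsmul ℝ, centroid]
  change _ - ((cluster c j).card : ℝ) • (((cluster c j).card : ℝ)⁻¹ • ∑ n ∈ cluster c j, x n) = 0
  rcases (cluster c j).eq_empty_or_nonempty with h | h
  · simp [h]
  · have : ((cluster c j).card : ℝ) ≠ 0 := by exact_mod_cast h.card_pos.ne'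
    rw [smul_inv_smul₀ this, sub_self]

/-- The squared distances between the points of a cluster add up to twice the cluster size times
the cluster cost. -/
theorem sum_sum_norm_sub_sq (x : Fin N → E) (c : Fin N → Fin l) (j : Fin l) :
    ∑ a ∈ cluster c j, ∑ b ∈ cluster c j, ‖x a - x b‖ ^ 2 =
      2 * (cluster c j).card * clusterCost x c j := by
  set μ := centroid x c j
  have key : ∀ a b, ‖x a - x b‖ ^ 2 =
      ‖x a - μ‖ ^ 2 + ‖x b - μ‖ ^ 2 - 2 * inner ℝ (x a - μ) (x b - μ) := fun a b => by
    rw [← sub_sub_sub_cancel_right (x a) (x b) μ, norm_sub_sq_real]; ring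
  have hμ : ∑ n ∈ cluster c j, (x n - μ) = 0 := sum_sub_centroid x c j
  have hcost : ∑ n ∈ cluster c j, ‖x n - μ‖ ^ 2 = clusterCost x c j := rfl
  simp_rw [key, Finset.sum_sub_distrib, Finset.sum_add_distrib, ← Finset.mul_sum, ← inner_sum,
    hμ, inner_zero_right, Finset.sum_const, nsmul_eq_mul, hcost, ← Finset.mul_sum, hcost]
  simp
  ring

/-- The centroid minimises the sum of the squared distances to the points of a cluster; here it
is compared with the origin. -/
theorem clusterCost_le_sum_norm_sq (x : Fin N → E) (c : Fin N → Fin l) (j : Fin l) :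
    clusterCost x c j ≤ ∑ n ∈ cluster c j, ‖x n‖ ^ 2 := by
  have h : ∑ n ∈ cluster c j, ‖x n‖ ^ 2 =
      clusterCost x c j + (cluster c j).card * ‖centroid x c j‖ ^ 2 := by
    have key : ∀ n, ‖x n‖ ^ 2 = ‖x n - centroid x c j‖ ^ 2 +
        2 * inner ℝ (x n - centroid x c j) (centroid x c j) + ‖centroid x c j‖ ^ 2 := fun n => by
      rw [← norm_add_sq_real, sub_add_cancel]
    simp_rw [key, Finset.sum_add_distrib, ← Finset.mul_sum, ← sum_inner, sum_sub_centroid]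
    simp [clusterCost]
  rw [h]
  exact le_add_of_nonneg_right (by positivity)

theorem potential_le_sum_norm_sq (x : Fin N → E) (c : Fin N → Fin l) :
    potential x c ≤ ∑ n, ‖x n‖ ^ 2 := by
  rw [← sum_clusterCost, ← sum_cluster c]
  exact Finset.sum_le_sum fun j _ => clusterCost_le_sum_norm_sq x c j

theorem centroid_map {F : Type*} [NormedAddCommGroup F] [InnerProductSpace ℝ F] (T : E →ₗ[ℝ] F)
    (x : Fin N → E) (c : Fin N → Fin l) (j : Fin l) :
    centroid (fun n => T (x n)) c j = T (centroid x c j) := by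
  simp [centroid]

/-- The potential splits along a subspace and its orthogonal complement. -/
theorem potential_eq_add_orthogonal [FiniteDimensional ℝ E] (x : Fin N → E) (c : Fin N → Fin l)
    (U : Submodule ℝ E) :
    potential x c = potential (fun n => U.starProjection (x n)) c +
      potential (fun n => Uᗮ.starProjection (x n)) c := by
  simp only [potential, ← Finset.sum_add_distrib]
  refine Finset.sum_congr rfl fun n _ => ?_
  have h1 := centroid_map (U.starProjection : E →ₗ[ℝ] E) x c (c n)
  have h2 := centroid_map (Uᗮ.starProjection : E →ₗ[ℝ] E) x c (c n)
  simp only [ContinuousLinearMap.coe_coe] at h1 h2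
  rw [h1, h2, ← map_sub, ← map_sub]
  exact Submodule.norm_sq_eq_add_norm_sq_starProjection _ _

end Clustering

/-! ### The squared distance to the nearest landmark -/

section LandmarkDist

variable {N : ℕ} {E : Type*} [NormedAddCommGroup E]

/-- The squared distance of `x n` to the nearest landmark, as a real number. -/
noncomputable def landmarkDist {s : ℕ} (x : Fin N → E) (z : Fin s → Fin N) (n : Fin N) : ℝ :=
  (sqDist x z n).toReal

variable {s : ℕ} (x : Fin N → E)

theorem landmarkDist_nonneg (z : Fin s → Fin N) (n : Fin N) : 0 ≤ landmarkDist x z n :=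
  ENNReal.toReal_nonneg

theorem landmarkDist_eq_iInf (z : Fin s → Fin N) (n : Fin N) :
    landmarkDist x z n = ⨅ j, ‖x n - x (z j)‖ ^ 2 := by
  rw [landmarkDist, sqDist, ENNReal.toReal_iInf fun j => ENNReal.pow_ne_top (edist_ne_top _ _)]
  simp [edist_dist, dist_eq_norm, ENNReal.toReal_pow]

theorem landmarkDist_le (z : Fin s → Fin N) (n : Fin N) (j : Fin s) :
    landmarkDist x z n ≤ ‖x n - x (z j)‖ ^ 2 := by
  rw [landmarkDist_eq_iInf]
  exact ciInf_le (Set.finite_range _).bddBelow j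

theorem exists_landmarkDist_eq (z : Fin (s + 1) → Fin N) (n : Fin N) :
    ∃ j, landmarkDist x z n = ‖x n - x (z j)‖ ^ 2 := by
  obtain ⟨j, hj⟩ := exists_eq_ciInf_of_finite (f := fun j => ‖x n - x (z j)‖ ^ 2)
  exact ⟨j, by rw [landmarkDist_eq_iInf, ← hj]⟩

theorem landmarkDist_snoc_le (z : Fin (s + 1) → Fin N) (n n' : Fin N) :
    landmarkDist x (Fin.snoc z n' : Fin (s + 2) → Fin N) n ≤ landmarkDist x z n := by
  obtain ⟨j, hj⟩ := exists_landmarkDist_eq x z n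
  rw [hj]
  simpa using landmarkDist_le x (Fin.snoc z n' : Fin (s + 2) → Fin N) n j.castSucc

theorem landmarkDist_snoc_le_norm (z : Fin s → Fin N) (n n' : Fin N) :
    landmarkDist x (Fin.snoc z n' : Fin (s + 1) → Fin N) n ≤ ‖x n - x n'‖ ^ 2 := by
  simpa using landmarkDist_le x (Fin.snoc z n' : Fin (s + 1) → Fin N) n (Fin.last s)

theorem landmarkDist_le_two_mul (z : Fin (s + 1) → Fin N) (a b : Fin N) :
    landmarkDist x z a ≤ 2 * (landmarkDist x z b + ‖x a - x b‖ ^ 2) := by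
  obtain ⟨j, hj⟩ := exists_landmarkDist_eq x z b
  have h1 := landmarkDist_le x z a j
  have h2 : ‖x a - x (z j)‖ ≤ ‖x a - x b‖ + ‖x b - x (z j)‖ := norm_sub_le_norm_sub_add_norm_sub ..
  have h3 : ‖x a - x (z j)‖ ^ 2 ≤ (‖x a - x b‖ + ‖x b - x (z j)‖) ^ 2 := by gcongr
  rw [hj]
  nlinarith [sq_nonneg (‖x a - x b‖ - ‖x b - x (z j)‖)]

end LandmarkDist

/-! ### One cluster under squared-distance sampling -/

section Cost

variable {N l s : ℕ} {E : Type*} [NormedAddCommGroup E]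

/-- The sum of the squared distances of the points of the `j`-th cluster to the landmarks. -/
noncomputable def landmarkCost (x : Fin N → E) (c : Fin N → Fin l) (z : Fin s → Fin N) (j : Fin l) : ℝ :=
  ∑ n ∈ cluster c j, landmarkDist x z n

theorem landmarkCost_nonneg (x : Fin N → E) (c : Fin N → Fin l) (z : Fin s → Fin N) (j : Fin l) :
    0 ≤ landmarkCost x c z j :=
  Finset.sum_nonneg fun _ _ => landmarkDist_nonneg _ _ _

theorem landmarkCost_snoc_le (x : Fin N → E) (c : Fin N → Fin l) (z : Fin (s + 1) → Fin N)
    (n : Fin N) (j : Fin l) :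
    landmarkCost x c (Fin.snoc z n : Fin (s + 2) → Fin N) j ≤ landmarkCost x c z j :=
  Finset.sum_le_sum fun _ _ => landmarkDist_snoc_le _ _ _ _

/-- A landmark that is drawn from a cluster with probabilities proportional to the squared
distances to the landmarks so far brings the expected cost of the cluster down to at most eight
times its cost about the centroid. The inequality is multiplied by the total weight
`landmarkCost x c z j`, so it holds also if this weight vanishes. -/
theorem sum_landmarkDist_mul_landmarkCost_snoc_le [InnerProductSpace ℝ E] (x : Fin N → E)
    (c : Fin N → Fin l) (z : Fin (s + 1) → Fin N) (j : Fin l) :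
    ∑ n ∈ cluster c j, landmarkDist x z n *
        landmarkCost x c (Fin.snoc z n : Fin (s + 2) → Fin N) j ≤
      8 * clusterCost x c j * landmarkCost x c z j := by
  rcases (cluster c j).eq_empty_or_nonempty with h | h
  · simp [landmarkCost, h]
  have hcard : (0 : ℝ) < (cluster c j).card := by exact_mod_cast h.card_pos
  set A := cluster c j
  set F := landmarkCost x c z j
  have hF : 0 ≤ F := landmarkCost_nonneg ..
  -- the weight of `a` is bounded by an average over the cluster
  have h1 : ∀ a, (A.card : ℝ) * landmarkDist x z a ≤ 2 * (F + ∑ b ∈ A, ‖x a - x b‖ ^ 2) := by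
    intro a
    have := Finset.sum_le_sum fun b (_ : b ∈ A) => landmarkDist_le_two_mul x z a b
    rwa [Finset.sum_const, nsmul_eq_mul, ← Finset.mul_sum, Finset.sum_add_distrib] at this
  have h2 : ∀ a, landmarkCost x c (Fin.snoc z a : Fin (s + 2) → Fin N) j ≤
      ∑ b ∈ A, ‖x a - x b‖ ^ 2 := fun a => Finset.sum_le_sum fun b _ => by
    rw [norm_sub_rev]; exact landmarkDist_snoc_le_norm _ _ _ _
  have h3 : ∀ a, (A.card : ℝ) * (landmarkDist x z a *
      landmarkCost x c (Fin.snoc z a : Fin (s + 2) → Fin N) j) ≤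
      4 * F * ∑ b ∈ A, ‖x a - x b‖ ^ 2 := by
    intro a
    have g1 := h1 a
    have g2 := h2 a
    have g3 := landmarkCost_snoc_le x c z a j
    have g4 := landmarkCost_nonneg x c (Fin.snoc z a : Fin (s + 2) → Fin N) j
    set G := landmarkCost x c (Fin.snoc z a : Fin (s + 2) → Fin N) j
    set S := ∑ b ∈ A, ‖x a - x b‖ ^ 2
    have g5 : 0 ≤ S := g4.trans g2
    calc _ = (A.card : ℝ) * landmarkDist x z a * G := by ring
      _ ≤ 2 * (F + S) * G := by gcongr
      _ = 2 * (F * G) + 2 * (S * G) := by ring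
      _ ≤ 2 * (F * S) + 2 * (S * F) := by gcongr
      _ = _ := by ring
  have h4 := Finset.sum_le_sum fun a (_ : a ∈ A) => h3 a
  rw [← Finset.mul_sum, ← Finset.mul_sum, sum_sum_norm_sub_sq] at h4
  refine le_of_mul_le_mul_left (h4.trans_eq ?_) hcard
  ring

end Cost

/-! ### Expectations under the sampling law -/

section Expectation

/-- The expectation of `f` under a law `p` on a finite type. -/
noncomputable def expect {α : Type*} [Fintype α] (p : PMF α) (f : α → ℝ) : ℝ :=
  ∑ a, (p a).toReal * f a

variable {α β : Type*} [Fintype α] [Fintype β]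

theorem expect_mono (p : PMF α) {f g : α → ℝ} (h : ∀ a, f a ≤ g a) : expect p f ≤ expect p g :=
  Finset.sum_le_sum fun a _ => mul_le_mul_of_nonneg_left (h a) ENNReal.toReal_nonneg

theorem expect_const (p : PMF α) (r : ℝ) : expect p (fun _ => r) = r := by
  have h : ∑ a, (p a).toReal = 1 := by
    rw [← ENNReal.toReal_sum fun a _ => p.apply_ne_top a, ← tsum_fintype (L := .unconditional _),
      p.tsum_coe, ENNReal.toReal_one]
  rw [expect, ← Finset.sum_mul, h, one_mul]

theorem expect_bind (p : PMF α) (q : α → PMF β) (f : β → ℝ) :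
    expect (p.bind q) f = expect p fun a => expect (q a) f := by
  have h : ∀ b, ((p.bind q) b).toReal = ∑ a, (p a).toReal * (q a b).toReal := fun b => by
    rw [PMF.bind_apply, tsum_fintype, ENNReal.toReal_sum fun a _ =>
      ENNReal.mul_ne_top (p.apply_ne_top a) ((q a).apply_ne_top b)]
    simp [ENNReal.toReal_mul]
  simp_rw [expect, h, Finset.sum_mul, Finset.mul_sum]
  rw [Finset.sum_comm]
  simp_rw [mul_assoc]

theorem expect_pure (a : α) (f : α → ℝ) : expect (PMF.pure a) f = f a := by
  classical
  rw [expect, Finset.sum_eq_single a] <;> simp +contextual [PMF.pure_apply]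

theorem expect_map (p : PMF α) (g : α → β) (f : β → ℝ) :
    expect (p.map g) f = expect p (f ∘ g) := by
  rw [PMF.map, expect_bind]
  simp [expect_pure, Function.comp_def]

variable {N : ℕ} [NeZero N] {E : Type*} [NormedAddCommGroup E] (x : Fin N → E)

theorem expect_landmarks_succ (s : ℕ) (f : (Fin (s + 1) → Fin N) → ℝ) :
    expect (landmarks x (s + 1)) f =
      expect (landmarks x s) fun z => expect (nextLandmark x z) fun n => f (Fin.snoc z n) := by
  rw [landmarks, expect_bind]
  simp only [expect_map, Function.comp_def]

theorem expect_nextLandmark_zero (z : Fin 0 → Fin N) (f : Fin N → ℝ) :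
    expect (nextLandmark x z) f = (N : ℝ)⁻¹ * ∑ n, f n := by
  simp [expect, nextLandmark, Finset.mul_sum]

theorem expect_nextLandmark {s : ℕ} (z : Fin (s + 1) → Fin N) (h : ∑ n, landmarkDist x z n ≠ 0)
    (f : Fin N → ℝ) :
    expect (nextLandmark x z) f =
      (∑ n, landmarkDist x z n)⁻¹ * ∑ n, landmarkDist x z n * f n := by
  have hne := tsum_sqDist_ne_top x z (by omega)
  have hsum : (∑' n, sqDist x z n).toReal = ∑ n, landmarkDist x z n := by
    rw [tsum_fintype] at hne ⊢
    exact ENNReal.toReal_sum fun n hn => ENNReal.sum_ne_top.1 hne n hn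
  have h0 : ¬ (s + 1 = 0 ∨ ∑' n, sqDist x z n = 0) := by
    rintro (h1 | h1)
    · omega
    · rw [h1] at hsum; exact h (by rw [← hsum]; rfl)
  rw [expect, nextLandmark, dif_neg h0]
  simp only [PMF.normalize_apply, ENNReal.toReal_mul, ENNReal.toReal_inv, hsum, Finset.mul_sum]
  refine Finset.sum_congr rfl fun n _ => ?_
  rw [landmarkDist]
  ring

end Expectation

/-! ### The k-means++ guarantee -/

section KMeans

variable {N l s : ℕ} {E : Type*} [NormedAddCommGroup E]

theorem sum_landmarkCost (x : Fin N → E) (c : Fin N → Fin l) (z : Fin s → Fin N) :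
    ∑ j, landmarkCost x c z j = ∑ n, landmarkDist x z n :=
  sum_cluster c _

variable [InnerProductSpace ℝ E]

/-- The clusters that contain no landmark. -/
def uncovered (c : Fin N → Fin l) (z : Fin s → Fin N) : Finset (Fin l) :=
  (Finset.univ.image (c ∘ z))ᶜ

/-- The cost charged to a cluster: its current cost if it holds a landmark, and otherwise the bound
on its expected cost after a landmark has been drawn from it. -/
noncomputable def chargedCost (x : Fin N → E) (c : Fin N → Fin l) (z : Fin s → Fin N)
    (j : Fin l) : ℝ :=
  if j ∈ uncovered c z then 8 * clusterCost x c j else landmarkCost x c z j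

/-- A bound on the expected cost of all clusters after `t` further landmarks have been drawn. The
second summand accounts for the clusters that stay uncovered; it is zero if there are none, by
division by zero. Empty clusters count as uncovered, so that there are always at least as many
uncovered clusters as draws to come. -/
noncomputable def valueBound (x : Fin N → E) (c : Fin N → Fin l) (t : ℕ) (z : Fin s → Fin N) : ℝ :=
  (∑ j, chargedCost x c z j) * (1 + (harmonic t : ℝ)) +
    ((uncovered c z).card - t : ℝ) / (uncovered c z).card *
      ∑ j ∈ uncovered c z, landmarkCost x c z j

theorem chargedCost_nonneg (x : Fin N → E) (c : Fin N → Fin l) (z : Fin s → Fin N) (j : Fin l) :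
    0 ≤ chargedCost x c z j := by
  rw [chargedCost]
  split_ifs
  · exact mul_nonneg (by norm_num) (clusterCost_nonneg ..)
  · exact landmarkCost_nonneg ..

theorem mem_uncovered {c : Fin N → Fin l} {z : Fin s → Fin N} {j : Fin l} :
    j ∈ uncovered c z ↔ ∀ i, c (z i) ≠ j := by
  simp [uncovered]

theorem card_uncovered (c : Fin N → Fin l) (z : Fin s → Fin N) :
    l ≤ (uncovered c z).card + s := by
  have h1 := Finset.card_compl (Finset.univ.image (c ∘ z))
  have h2 : (Finset.univ.image (c ∘ z)).card ≤ s := by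
    simpa using Finset.card_image_le (s := Finset.univ) (f := c ∘ z)
  rw [Fintype.card_fin] at h1
  rw [uncovered]
  omega

theorem uncovered_snoc (c : Fin N → Fin l) (z : Fin s → Fin N) (n : Fin N) :
    uncovered c (Fin.snoc z n : Fin (s + 1) → Fin N) = (uncovered c z).erase (c n) := by
  ext j
  simp only [mem_uncovered, Finset.mem_erase, Fin.forall_fin_succ', Fin.snoc_castSucc,
    Fin.snoc_last]
  tauto

theorem harmonic_nonneg (t : ℕ) : (0 : ℝ) ≤ harmonic t := by
  rw [harmonic]
  push_cast
  positivity

theorem harmonic_succ_real (t : ℕ) : (harmonic (t + 1) : ℝ) = harmonic t + 1 / ((t : ℝ) + 1) := by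
  rw [harmonic_succ]
  push_cast
  rw [one_div]

/-- A landmark from a covered cluster lowers all costs and leaves the uncovered clusters as they
are. -/
theorem valueBound_snoc_le_of_notMem (x : Fin N → E) (c : Fin N → Fin l) (t : ℕ)
    (z : Fin (s + 1) → Fin N) (n : Fin N) (hn : c n ∉ uncovered c z)
    (ht : t ≤ (uncovered c z).card) :
    valueBound x c t (Fin.snoc z n : Fin (s + 2) → Fin N) ≤ valueBound x c t z := by
  have hu : uncovered c (Fin.snoc z n : Fin (s + 2) → Fin N) = uncovered c z := by
    rw [uncovered_snoc, Finset.erase_eq_of_notMem hn]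
  have ht' : (0 : ℝ) ≤ (uncovered c z).card - t := sub_nonneg.2 (by exact_mod_cast ht)
  have hh := harmonic_nonneg t
  rw [valueBound, valueBound, hu]
  gcongr with j _ j _
  · rw [chargedCost, chargedCost, hu]
    split_ifs
    · exact le_rfl
    · exact landmarkCost_snoc_le ..
  · exact landmarkCost_snoc_le ..

/-- A landmark from an uncovered cluster replaces the charge of this cluster by its new cost. -/
theorem valueBound_snoc_le_of_mem (x : Fin N → E) (c : Fin N → Fin l) (t : ℕ)
    (z : Fin (s + 1) → Fin N) (n : Fin N) (hn : c n ∈ uncovered c z)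
    (ht : t + 1 ≤ (uncovered c z).card) :
    valueBound x c t (Fin.snoc z n : Fin (s + 2) → Fin N) ≤
      (∑ j, chargedCost x c z j - 8 * clusterCost x c (c n) +
          landmarkCost x c (Fin.snoc z n : Fin (s + 2) → Fin N) (c n)) * (1 + (harmonic t : ℝ)) +
        ((uncovered c z).card - 1 - t : ℝ) / ((uncovered c z).card - 1) *
          (∑ j ∈ uncovered c z, landmarkCost x c z j - landmarkCost x c z (c n)) := by
  have hcard : ((uncovered c (Fin.snoc z n : Fin (s + 2) → Fin N)).card : ℝ) =
      (uncovered c z).card - 1 := by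
    rw [uncovered_snoc, Finset.card_erase_of_mem hn, Nat.cast_sub (by omega), Nat.cast_one]
  have ht' : (0 : ℝ) ≤ (uncovered c z).card - 1 - t := by
    have : (t + 1 : ℝ) ≤ (uncovered c z).card := by exact_mod_cast ht
    linarith
  have ht'' : (0 : ℝ) ≤ (uncovered c z).card - 1 := ht'.trans (by simp)
  have hh := harmonic_nonneg t
  rw [valueBound, hcard, uncovered_snoc, ← Finset.sum_erase_eq_sub hn]
  gcongr with j _
  · rw [← Finset.add_sum_erase _ _ (Finset.mem_univ (c n)),
      ← Finset.add_sum_erase _ (chargedCost x c z) (Finset.mem_univ (c n))]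
    have h1 : chargedCost x c z (c n) = 8 * clusterCost x c (c n) := by
      rw [chargedCost, if_pos hn]
    have h2 : chargedCost x c (Fin.snoc z n : Fin (s + 2) → Fin N) (c n) =
        landmarkCost x c (Fin.snoc z n : Fin (s + 2) → Fin N) (c n) := by
      rw [chargedCost, if_neg (by simp [uncovered_snoc])]
    have h3 : ∑ j ∈ Finset.univ.erase (c n), chargedCost x c (Fin.snoc z n : Fin (s + 2) → Fin N) j ≤
        ∑ j ∈ Finset.univ.erase (c n), chargedCost x c z j := by
      refine Finset.sum_le_sum fun j hj => ?_
      have hj' : j ∈ (uncovered c z).erase (c n) ↔ j ∈ uncovered c z := by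
        simp [Finset.ne_of_mem_erase hj]
      simp only [chargedCost, uncovered_snoc, hj']
      split_ifs
      · exact le_rfl
      · exact landmarkCost_snoc_le ..
    rw [h1, h2]
    linarith
  · exact landmarkCost_snoc_le ..

/-- The numerical inequality behind one sampling step: `u` is the number of uncovered clusters, `V`
their total cost, `Q` the sum of the squares of their costs, `C` the cost of the covered clusters
and `W` the total charge. For `u = 1` the quotient by `u - 1` on the left is zero. -/
theorem step_inequality {u t C V Q W : ℝ} (hu : t + 1 ≤ u) (ht : 0 ≤ t) (hC : 0 ≤ C)
    (hCW : C ≤ W) (hV : 0 ≤ V) (hQ : V ^ 2 ≤ u * Q) :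
    C * ((u - t) / u * V) + (u - 1 - t) / (u - 1) * (V ^ 2 - Q) ≤
      (C + V) * (W * (1 / (t + 1)) + (u - (t + 1)) / u * V) := by
  have hu0 : 0 < u := by linarith
  have h1 : (u - 1 - t) / (u - 1) * (V ^ 2 - Q) ≤ (u - 1 - t) / u * V ^ 2 := by
    rcases eq_or_lt_of_le (show (0 : ℝ) ≤ u - 1 by linarith) with h | h
    · rw [← h, div_zero, zero_mul]
      exact mul_nonneg (div_nonneg (by linarith) hu0.le) (sq_nonneg V)
    · rw [div_mul_eq_mul_div, div_mul_eq_mul_div, div_le_div_iff₀ h hu0]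
      have : (V ^ 2 - Q) * u ≤ V ^ 2 * (u - 1) := by linarith
      calc _ = (u - 1 - t) * ((V ^ 2 - Q) * u) := by ring
        _ ≤ (u - 1 - t) * (V ^ 2 * (u - 1)) := by gcongr; linarith
        _ = _ := by ring
  have h2 : C * V / u ≤ (C + V) * (W * (1 / (t + 1))) := by
    calc C * V / u = C * V * (1 / u) := by ring
      _ ≤ (W * (C + V)) * (1 / (t + 1)) := by
        have hW : 0 ≤ W := hC.trans hCW
        gcongr
        linarith
      _ = _ := by ring
  have h3 : C * ((u - t) / u * V) + (u - 1 - t) / u * V ^ 2 =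
      C * V / u + (C + V) * ((u - (t + 1)) / u * V) := by ring
  linarith

/-- One step of sampling does not raise the bound in expectation. -/
theorem expect_nextLandmark_valueBound_le [NeZero N] (x : Fin N → E) (c : Fin N → Fin l) (t : ℕ)
    (z : Fin (s + 1) → Fin N) (ht : t + 1 ≤ (uncovered c z).card) :
    expect (nextLandmark x z)
        (fun n => valueBound x c t (Fin.snoc z n : Fin (s + 2) → Fin N)) ≤
      valueBound x c (t + 1) z := by
  have hh := harmonic_nonneg t
  have htu : (t : ℝ) + 1 ≤ (uncovered c z).card := by exact_mod_cast ht
  have hW : 0 ≤ ∑ j, chargedCost x c z j := Finset.sum_nonneg fun j _ => chargedCost_nonneg ..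
  rcases eq_or_ne (∑ n, landmarkDist x z n) 0 with h0 | h0
  · -- all costs vanish already, and only the charges of uncovered clusters are left
    have hz : ∀ j, landmarkCost x c z j = 0 := fun j => by
      rw [← sum_landmarkCost x c] at h0
      exact (Finset.sum_eq_zero_iff_of_nonneg fun j _ => landmarkCost_nonneg ..).1 h0 j
        (Finset.mem_univ j)
    have hz' : ∀ n j, landmarkCost x c (Fin.snoc z n : Fin (s + 2) → Fin N) j = 0 := fun n j =>
      le_antisymm ((landmarkCost_snoc_le ..).trans_eq (hz j)) (landmarkCost_nonneg ..)
    rw [← expect_const (nextLandmark x z) (valueBound x c (t + 1) z)]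
    refine expect_mono _ fun n => ?_
    simp only [valueBound, hz, hz', Finset.sum_const_zero, mul_zero, add_zero, harmonic_succ_real]
    have hpos : (0 : ℝ) ≤ 1 / (t + 1) := by positivity
    refine mul_le_mul (Finset.sum_le_sum fun j _ => ?_) (by linarith) (by positivity) hW
    have := clusterCost_nonneg x c j
    simp only [chargedCost, hz, hz', uncovered_snoc, Finset.mem_erase]
    split_ifs with h1 h2 h2
    · exact le_rfl
    · exact absurd h1.2 h2
    · positivity
    · exact le_rfl
  have hS : 0 < ∑ n, landmarkDist x z n :=
    lt_of_le_of_ne (Finset.sum_nonneg fun n _ => landmarkDist_nonneg ..) h0.symm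
  rw [expect_nextLandmark x z h0, inv_mul_le_iff₀ hS]
  set V := ∑ j ∈ uncovered c z, landmarkCost x c z j with hV
  set C := ∑ j ∈ (uncovered c z)ᶜ, landmarkCost x c z j with hC
  set W := ∑ j, chargedCost x c z j with hWdef
  set u : ℝ := ((uncovered c z).card : ℝ) with hu
  set Q := ∑ j ∈ uncovered c z, landmarkCost x c z j ^ 2 with hQdef
  set h : ℝ := 1 + harmonic t with hhdef
  have hCV : C + V = ∑ n, landmarkDist x z n := by
    rw [hC, hV, Finset.sum_compl_add_sum, sum_landmarkCost]
  have hV0 : 0 ≤ V := Finset.sum_nonneg fun j _ => landmarkCost_nonneg ..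
  have hC0 : 0 ≤ C := Finset.sum_nonneg fun j _ => landmarkCost_nonneg ..
  have hCW : C ≤ W := by
    calc C = ∑ j ∈ (uncovered c z)ᶜ, chargedCost x c z j :=
          Finset.sum_congr rfl fun j hj => by rw [chargedCost, if_neg (Finset.mem_compl.1 hj)]
      _ ≤ W := Finset.sum_le_univ_sum_of_nonneg fun j => chargedCost_nonneg ..
  have hQ : V ^ 2 ≤ u * Q := sq_sum_le_card_mul_sum_sq
  have hcov : ∀ j ∈ (uncovered c z)ᶜ, ∑ n ∈ cluster c j, landmarkDist x z n *
      valueBound x c t (Fin.snoc z n : Fin (s + 2) → Fin N) ≤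
      landmarkCost x c z j * (W * h + (u - t) / u * V) := by
    intro j hj
    rw [landmarkCost, Finset.sum_mul]
    refine Finset.sum_le_sum fun n hn => mul_le_mul_of_nonneg_left ?_ (landmarkDist_nonneg ..)
    refine valueBound_snoc_le_of_notMem x c t z n ?_ (by omega)
    rw [mem_cluster.1 hn]
    exact Finset.mem_compl.1 hj
  have hunc : ∀ j ∈ uncovered c z, ∑ n ∈ cluster c j, landmarkDist x z n *
      valueBound x c t (Fin.snoc z n : Fin (s + 2) → Fin N) ≤
      landmarkCost x c z j * (W * h) +
        (u - 1 - t) / (u - 1) * (landmarkCost x c z j * V - landmarkCost x c z j ^ 2) := by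
    intro j hj
    have key := sum_landmarkDist_mul_landmarkCost_snoc_le x c z j
    calc _ ≤ ∑ n ∈ cluster c j, landmarkDist x z n * ((W - 8 * clusterCost x c j +
          landmarkCost x c (Fin.snoc z n : Fin (s + 2) → Fin N) j) * h +
        (u - 1 - t) / (u - 1) * (V - landmarkCost x c z j)) := by
          refine Finset.sum_le_sum fun n hn =>
            mul_le_mul_of_nonneg_left ?_ (landmarkDist_nonneg ..)
          have hn' := mem_cluster.1 hn
          subst hn'
          exact valueBound_snoc_le_of_mem x c t z n hj ht
      _ = landmarkCost x c z j * ((W - 8 * clusterCost x c j) * h +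
          (u - 1 - t) / (u - 1) * (V - landmarkCost x c z j)) +
          (∑ n ∈ cluster c j, landmarkDist x z n *
            landmarkCost x c (Fin.snoc z n : Fin (s + 2) → Fin N) j) * h := by
          rw [landmarkCost, Finset.sum_mul, Finset.sum_mul, ← Finset.sum_add_distrib]
          exact Finset.sum_congr rfl fun n _ => by ring
      _ ≤ landmarkCost x c z j * ((W - 8 * clusterCost x c j) * h +
          (u - 1 - t) / (u - 1) * (V - landmarkCost x c z j)) +
          (8 * clusterCost x c j * landmarkCost x c z j) * h := by gcongr
      _ = _ := by ring
  have hstep := step_inequality htu (Nat.cast_nonneg t) hC0 hCW hV0 hQ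
  rw [← sum_cluster c, ← Finset.sum_compl_add_sum (uncovered c z)]
  refine (add_le_add (Finset.sum_le_sum hcov) (Finset.sum_le_sum hunc)).trans ?_
  rw [← Finset.sum_mul, Finset.sum_add_distrib, ← Finset.sum_mul, ← Finset.mul_sum,
    Finset.sum_sub_distrib, ← Finset.sum_mul, ← hC, ← hV, ← hQdef, ← hCV, valueBound,
    harmonic_succ_real, ← hu, ← hWdef, ← hV, Nat.cast_succ]
  calc C * (W * h + (u - t) / u * V) + (V * (W * h) + (u - 1 - t) / (u - 1) * (V * V - Q))
      = (C + V) * (W * h) +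
        (C * ((u - t) / u * V) + (u - 1 - t) / (u - 1) * (V ^ 2 - Q)) := by ring
    _ ≤ (C + V) * (W * h) + (C + V) * (W * (1 / (t + 1)) + (u - (t + 1)) / u * V) := by gcongr
    _ = _ := by rw [hhdef]; ring

theorem expect_landmarks_valueBound_le [NeZero N] (x : Fin N → E) (c : Fin N → Fin l) (s : ℕ)
    (hs : s + 1 ≤ l) :
    expect (landmarks x (s + 1)) (valueBound x c (l - (s + 1))) ≤
      expect (landmarks x 1) (valueBound x c (l - 1)) := by
  induction s with
  | zero => exact le_rfl
  | succ s ih =>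
    refine le_trans ?_ (ih (by omega))
    rw [expect_landmarks_succ]
    refine expect_mono _ fun z => ?_
    rw [show l - (s + 1) = l - (s + 1 + 1) + 1 by omega]
    refine expect_nextLandmark_valueBound_le x c _ z ?_
    have := card_uncovered c z
    omega

/-- The first landmark is uniform, so that it doubles the cost of the cluster it falls into on
average, while all other clusters are charged eight times their cost. -/
theorem expect_landmarks_one_valueBound_le [NeZero N] (x : Fin N → E) (c : Fin N → Fin l) :
    expect (landmarks x 1) (valueBound x c (l - 1)) ≤
      8 * (1 + (harmonic (l - 1) : ℝ)) * potential x c := by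
  have hh := harmonic_nonneg (l - 1)
  have hN : (0 : ℝ) < N := by exact_mod_cast Nat.pos_of_ne_zero (NeZero.ne N)
  rw [expect_landmarks_succ, landmarks, expect_pure, expect_nextLandmark_zero,
    inv_mul_le_iff₀ hN]
  have hpoint : ∀ n, valueBound x c (l - 1) (Fin.snoc Fin.elim0 n : Fin 1 → Fin N) ≤
      (8 * potential x c - 8 * clusterCost x c (c n) +
        ∑ m ∈ cluster c (c n), ‖x m - x n‖ ^ 2) * (1 + (harmonic (l - 1) : ℝ)) := by
    intro n
    have hl : 0 < l := (c n).pos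
    have hunc : uncovered c (Fin.snoc Fin.elim0 n : Fin 1 → Fin N) = Finset.univ.erase (c n) := by
      rw [uncovered_snoc, uncovered]
      simp
    have hcard : ((uncovered c (Fin.snoc Fin.elim0 n : Fin 1 → Fin N)).card : ℝ) = (l - 1 : ℕ) := by
      rw [hunc, Finset.card_erase_of_mem (Finset.mem_univ _), Finset.card_univ, Fintype.card_fin]
    rw [valueBound, hcard, sub_self, zero_div, zero_mul, add_zero]
    gcongr
    rw [← sum_clusterCost, Finset.mul_sum, ← Finset.add_sum_erase _ _ (Finset.mem_univ (c n)),
      ← Finset.add_sum_erase _ (fun j => 8 * clusterCost x c j) (Finset.mem_univ (c n))]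
    have h1 : chargedCost x c (Fin.snoc Fin.elim0 n : Fin 1 → Fin N) (c n) ≤
        ∑ m ∈ cluster c (c n), ‖x m - x n‖ ^ 2 := by
      rw [chargedCost, if_neg (by simp [hunc])]
      exact Finset.sum_le_sum fun m _ => landmarkDist_snoc_le_norm ..
    have h2 : ∑ j ∈ Finset.univ.erase (c n),
        chargedCost x c (Fin.snoc Fin.elim0 n : Fin 1 → Fin N) j =
        ∑ j ∈ Finset.univ.erase (c n), 8 * clusterCost x c j :=
      Finset.sum_congr rfl fun j hj => by rw [chargedCost, if_pos (by rwa [hunc])]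
    linarith
  refine (Finset.sum_le_sum fun n _ => hpoint n).trans ?_
  rw [← Finset.sum_mul]
  have hsum : ∑ n, (8 * potential x c - 8 * clusterCost x c (c n) +
        ∑ m ∈ cluster c (c n), ‖x m - x n‖ ^ 2) ≤ N * (8 * potential x c) := by
    rw [Finset.sum_add_distrib, Finset.sum_sub_distrib, Finset.sum_const, nsmul_eq_mul,
      Finset.card_univ, Fintype.card_fin]
    have h1 : ∑ n, ∑ m ∈ cluster c (c n), ‖x m - x n‖ ^ 2 =
        ∑ j, 2 * (cluster c j).card * clusterCost x c j := by
      rw [← sum_cluster c]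
      refine Finset.sum_congr rfl fun j _ => ?_
      rw [← sum_sum_norm_sub_sq]
      refine Finset.sum_congr rfl fun n hn => ?_
      rw [mem_cluster.1 hn]
      exact Finset.sum_congr rfl fun m _ => by rw [norm_sub_rev]
    have h2 : ∑ n, 8 * clusterCost x c (c n) =
        ∑ j, 8 * (cluster c j).card * clusterCost x c j := by
      rw [← sum_cluster c]
      refine Finset.sum_congr rfl fun j _ => ?_
      rw [Finset.sum_congr rfl fun n hn => by rw [mem_cluster.1 hn], Finset.sum_const,
        nsmul_eq_mul]
      ring
    have h3 : ∑ j, 2 * (cluster c j).card * clusterCost x c j ≤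
        ∑ j, 8 * (cluster c j).card * clusterCost x c j := by
      gcongr with j _
      · exact clusterCost_nonneg ..
      · norm_num
    linarith
  calc _ ≤ N * (8 * potential x c) * (1 + (harmonic (l - 1) : ℝ)) := by gcongr
    _ = _ := by ring

/-- The k-means++ guarantee: the expected sum of the squared distances to the nearest of `l`
landmarks is within a logarithmic factor of the potential of any `l`-clustering. -/
theorem expect_sum_landmarkDist_le [NeZero N] (x : Fin N → E) (c : Fin N → Fin l) :
    expect (landmarks x l) (fun z => ∑ n, landmarkDist x z n) ≤
      8 * (1 + (harmonic (l - 1) : ℝ)) * potential x c := by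
  obtain ⟨s, rfl⟩ : ∃ s, l = s + 1 := ⟨l - 1, by have := (c 0).pos; omega⟩
  refine le_trans ?_ (expect_landmarks_one_valueBound_le x c)
  refine le_trans (expect_mono _ fun z => ?_) (expect_landmarks_valueBound_le x c s le_rfl)
  rw [valueBound, Nat.sub_self, harmonic_zero, Nat.cast_zero, sub_zero, ← sum_landmarkCost x c,
    ← Finset.sum_compl_add_sum (uncovered c z)]
  have h1 : ∑ j ∈ (uncovered c z)ᶜ, landmarkCost x c z j ≤ ∑ j, chargedCost x c z j := by
    calc _ = ∑ j ∈ (uncovered c z)ᶜ, chargedCost x c z j :=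
          Finset.sum_congr rfl fun j hj => by rw [chargedCost, if_neg (Finset.mem_compl.1 hj)]
      _ ≤ _ := Finset.sum_le_univ_sum_of_nonneg fun j => chargedCost_nonneg ..
  rcases (uncovered c z).eq_empty_or_nonempty with h | h
  · rw [h] at h1 ⊢
    simpa using h1
  · rw [div_self (by exact_mod_cast h.card_pos.ne')]
    push_cast
    linarith

end KMeans

/-! ### The Nyström error as a Gram matrix of residuals -/

section Nystrom

open Matrix

theorem self_mul_pinv_mul_self {l : ℕ} {A : Matrix (Fin l) (Fin l) ℝ} (hA : A.IsHermitian) :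
    A * pinv hA * A = A := by
  have hspec : A = (hA.eigenvectorUnitary : Matrix (Fin l) (Fin l) ℝ) *
      diagonal hA.eigenvalues * star (hA.eigenvectorUnitary : Matrix (Fin l) (Fin l) ℝ) := by
    have := hA.spectral_theorem
    rwa [Unitary.conjStarAlgAut_apply] at this
  have hu : star (hA.eigenvectorUnitary : Matrix (Fin l) (Fin l) ℝ) * hA.eigenvectorUnitary = 1 :=
    Unitary.coe_star_mul_self hA.eigenvectorUnitary
  have hd : diagonal hA.eigenvalues * (diagonal (fun i => (hA.eigenvalues i)⁻¹) *
      diagonal hA.eigenvalues) = diagonal hA.eigenvalues := by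
    rw [diagonal_mul_diagonal, diagonal_mul_diagonal]
    congr 1
    ext i
    rw [← mul_assoc, mul_inv_mul_cancel]
  have key : ∀ Q D D' : Matrix (Fin l) (Fin l) ℝ, star Q * Q = 1 → D * (D' * D) = D →
      Q * D * star Q * (Q * D' * star Q) * (Q * D * star Q) = Q * D * star Q := by
    intro Q D D' hQ hD
    calc _ = Q * (D * ((star Q * Q) * D' * (star Q * Q) * D)) * star Q := by
          simp only [Matrix.mul_assoc]
      _ = _ := by rw [hQ, Matrix.one_mul, Matrix.mul_one, hD]
  have := key _ _ _ hu hd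
  rw [← hspec] at this
  exact this

variable {N l : ℕ} {E : Type*} [NormedAddCommGroup E] [InnerProductSpace ℝ E]

/-- What remains of `x n` after the combination of landmarks with coefficients `C W⁺` is
subtracted, where `C` and `W` are the blocks of the Gram matrix that enter `nystrom`. -/
noncomputable def residual {A : Matrix (Fin N) (Fin N) ℝ} (hA : A.IsHermitian) (x : Fin N → E)
    (z : Fin l → Fin N) (n : Fin N) : E :=
  x n - ∑ j, (A.submatrix id z * pinv (hA.submatrix z)) n j • x (z j)

variable {A : Matrix (Fin N) (Fin N) ℝ} (hA : A.IsHermitian) {x : Fin N → E}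
  (hx : ∀ n m, A n m = inner ℝ (x n) (x m)) (z : Fin l → Fin N)

/-- A kernel vector of the landmark block of a Gram matrix gives a vanishing combination of the
landmarks, and so it is annihilated by all landmark columns. -/
theorem submatrix_mulVec_eq_zero {A : Matrix (Fin N) (Fin N) ℝ}
    (hx : ∀ n m, A n m = inner ℝ (x n) (x m)) (z : Fin l → Fin N) {v : Fin l → ℝ}
    (hv : A.submatrix z z *ᵥ v = 0) : A.submatrix id z *ᵥ v = 0 := by
  have hn : ∀ n, ∑ j, A n (z j) * v j = inner ℝ (x n) (∑ j, v j • x (z j)) := fun n => by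
    rw [inner_sum]
    exact Finset.sum_congr rfl fun j _ => by rw [real_inner_smul_right, hx, mul_comm]
  have h0 : ∑ j, v j • x (z j) = 0 := by
    rw [← inner_self_eq_zero (𝕜 := ℝ), sum_inner]
    refine Finset.sum_eq_zero fun i _ => ?_
    rw [real_inner_smul_left, ← hn]
    have := congrFun hv i
    rw [mulVec, dotProduct] at this
    exact mul_eq_zero_of_right _ this
  ext n
  rw [mulVec, dotProduct]
  simp only [submatrix_apply, id, hn, h0, inner_zero_right, Pi.zero_apply]

include hx

theorem submatrix_mul_pinv_mul_submatrix :
    A.submatrix id z * pinv (hA.submatrix z) * A.submatrix z z = A.submatrix id z := by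
  have h1 : A.submatrix z z * (1 - pinv (hA.submatrix z) * A.submatrix z z) = 0 := by
    rw [Matrix.mul_sub, Matrix.mul_one, ← Matrix.mul_assoc, self_mul_pinv_mul_self, sub_self]
  have h2 : A.submatrix id z * (1 - pinv (hA.submatrix z) * A.submatrix z z) = 0 := by
    ext n j
    refine congrFun (submatrix_mulVec_eq_zero hx z
      (v := (1 - pinv (hA.submatrix z) * A.submatrix z z).col j) ?_) n
    ext i
    exact congrFun (congrFun h1 i) j
  rw [Matrix.mul_sub, Matrix.mul_one, sub_eq_zero, ← Matrix.mul_assoc] at h2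
  exact h2.symm

theorem inner_residual_landmark (n : Fin N) (i : Fin l) :
    inner ℝ (residual hA x z n) (x (z i)) = 0 := by
  have h := congrFun (congrFun (submatrix_mul_pinv_mul_submatrix hA hx z) n) i
  rw [Matrix.mul_apply] at h
  simp only [submatrix_apply, id] at h
  rw [residual, inner_sub_left, sum_inner, ← hx, sub_eq_zero, ← h]
  exact Finset.sum_congr rfl fun j _ => by rw [real_inner_smul_left, hx]

theorem inner_residual_residual (n m : Fin N) :
    inner ℝ (residual hA x z n) (residual hA x z m) = (A - nystrom hA z) n m := by
  have h : inner ℝ (residual hA x z n) (residual hA x z m) =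
      inner ℝ (residual hA x z n) (x m) := by
    conv_lhs => rw [residual.eq_def hA x z m, inner_sub_right, inner_sum]
    simp [real_inner_smul_right, inner_residual_landmark hA hx]
  rw [h, residual, inner_sub_left, sum_inner, ← hx, Matrix.sub_apply, nystrom, Matrix.mul_apply]
  congr 1
  refine Finset.sum_congr rfl fun j _ => ?_
  rw [real_inner_smul_left, transpose_apply, submatrix_apply, id, hx m, real_inner_comm]

/-- The residual is orthogonal to the landmarks, hence no longer than the difference to any of
them. -/
theorem norm_residual_sq_le (n : Fin N) (i : Fin l) :
    ‖residual hA x z n‖ ^ 2 ≤ ‖x n - x (z i)‖ ^ 2 := by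
  set p := ∑ j, (A.submatrix id z * pinv (hA.submatrix z)) n j • x (z j) with hp
  have h1 : x n - x (z i) = residual hA x z n + (p - x (z i)) := by rw [residual]; abel
  have h2 : inner ℝ (residual hA x z n) (p - x (z i)) = 0 := by
    rw [hp, inner_sub_right, inner_sum]
    simp [real_inner_smul_right, inner_residual_landmark hA hx]
  rw [h1, norm_add_sq_real, h2]
  nlinarith [sq_nonneg ‖p - x (z i)‖]

omit hx in
/-- The Frobenius norm of a Gram matrix is at most its trace. -/
theorem frobNorm_le_sum_norm_sq {B : Matrix (Fin N) (Fin N) ℝ} {r : Fin N → E}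
    (hB : ∀ n m, B n m = inner ℝ (r n) (r m)) : frobNorm B ≤ ∑ n, ‖r n‖ ^ 2 := by
  refine Real.sqrt_le_iff.2 ⟨Finset.sum_nonneg fun _ _ => sq_nonneg _, ?_⟩
  rw [sq (∑ n, ‖r n‖ ^ 2), Finset.sum_mul_sum]
  refine Finset.sum_le_sum fun n _ => Finset.sum_le_sum fun m _ => ?_
  rw [hB, ← mul_pow, ← sq_abs]
  gcongr
  exact abs_real_inner_le_norm _ _

end Nystrom

/-- The Nyström error is at most the sum of the squared distances to the nearest landmarks. -/
theorem frobNorm_sub_nystrom_le {N s : ℕ} {E : Type*} [NormedAddCommGroup E]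
    [InnerProductSpace ℝ E] {A : Matrix (Fin N) (Fin N) ℝ} (hA : A.IsHermitian) {x : Fin N → E}
    (hx : ∀ n m, A n m = inner ℝ (x n) (x m)) (z : Fin (s + 1) → Fin N) :
    frobNorm (A - nystrom hA z) ≤ ∑ n, landmarkDist x z n := by
  refine (frobNorm_le_sum_norm_sq fun n m => (inner_residual_residual hA hx z n m).symm).trans ?_
  refine Finset.sum_le_sum fun n _ => ?_
  obtain ⟨j, hj⟩ := exists_landmarkDist_eq x z n
  rw [hj]
  exact norm_residual_sq_le hA hx z n j

/-- The expected Nyström error is within a logarithmic factor of the potential of any clustering of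
the feature vectors. -/
theorem expectedError_le {d N l : ℕ} [NeZero N] (k : ℕ) (y : Fin N → EuclideanSpace ℝ (Fin d))
    (c : Fin N → Fin l) :
    expectedError k y l ≤
      8 * (1 + (harmonic (l - 1) : ℝ)) * potential (fun n => feature k (y n)) c := by
  refine le_trans ?_ (expect_sum_landmarkDist_le (fun n => feature k (y n)) c)
  obtain ⟨s, rfl⟩ : ∃ s, l = s + 1 := ⟨l - 1, by have := (c 0).pos; omega⟩
  exact expect_mono _ fun z => frobNorm_sub_nystrom_le (gram_isHermitian k y)
    (fun n m => by rw [inner_feature]; rfl) z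

/-! ### Spectral tails -/

section Spectral

open Matrix

variable {N : ℕ}

/-- The orthogonal matrix with columns `u i`. -/
noncomputable def basisMatrix (u : OrthonormalBasis (Fin N) ℝ (EuclideanSpace ℝ (Fin N))) :
    Matrix (Fin N) (Fin N) ℝ :=
  Matrix.of fun n i => u i n

theorem basisMatrix_transpose_mul (u : OrthonormalBasis (Fin N) ℝ (EuclideanSpace ℝ (Fin N))) :
    (basisMatrix u)ᵀ * basisMatrix u = 1 := by
  ext i j
  have := orthonormal_iff_ite.1 u.orthonormal j i
  rw [PiLp.inner_apply] at this
  simp only [RCLike.inner_apply, conj_trivial] at this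
  rw [Matrix.mul_apply, Matrix.one_apply]
  simp only [transpose_apply, basisMatrix, of_apply, this, eq_comm]

theorem basisMatrix_mul_transpose (u : OrthonormalBasis (Fin N) ℝ (EuclideanSpace ℝ (Fin N))) :
    basisMatrix u * (basisMatrix u)ᵀ = 1 :=
  mul_eq_one_comm.1 (basisMatrix_transpose_mul u)

theorem frobNorm_eq_sqrt_trace (A : Matrix (Fin N) (Fin N) ℝ) :
    frobNorm A = √(A * Aᵀ).trace := by
  simp [frobNorm, Matrix.trace, Matrix.mul_apply, sq]

/-- The Frobenius norm is invariant under an orthogonal change of basis. -/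
theorem frobNorm_mul_diagonal_mul_transpose
    (u : OrthonormalBasis (Fin N) ℝ (EuclideanSpace ℝ (Fin N))) (v : Fin N → ℝ) :
    frobNorm (basisMatrix u * diagonal v * (basisMatrix u)ᵀ) = √(∑ i, v i ^ 2) := by
  have h : basisMatrix u * diagonal v * (basisMatrix u)ᵀ *
      (basisMatrix u * diagonal v * (basisMatrix u)ᵀ)ᵀ =
      basisMatrix u * (diagonal v * (((basisMatrix u)ᵀ * basisMatrix u) * diagonal v)) *
        (basisMatrix u)ᵀ := by
    simp only [transpose_mul, transpose_transpose, diagonal_transpose, Matrix.mul_assoc]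
  rw [frobNorm_eq_sqrt_trace, h, Matrix.trace_mul_comm, ← Matrix.mul_assoc,
    basisMatrix_transpose_mul, Matrix.one_mul, Matrix.one_mul, diagonal_mul_diagonal,
    trace_diagonal]
  simp_rw [sq]

variable {A : Matrix (Fin N) (Fin N) ℝ} {lam : Fin N → ℝ}
  {u : OrthonormalBasis (Fin N) ℝ (EuclideanSpace ℝ (Fin N))}

theorem IsSpectralDecomposition.eq_mul_diagonal_mul (h : IsSpectralDecomposition A lam u) :
    A = basisMatrix u * diagonal lam * (basisMatrix u)ᵀ := by
  have h1 : A * basisMatrix u = basisMatrix u * diagonal lam := by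
    ext n i
    rw [mul_diagonal, mul_comm]
    exact congrFun (h.2 i) n
  rw [← h1, Matrix.mul_assoc, basisMatrix_mul_transpose, Matrix.mul_one]

/-- The error of an optimal rank-`m` approximation is at most the error of the truncated spectral
decomposition. -/
theorem IsSpectralDecomposition.frobNorm_sub_le (h : IsSpectralDecomposition A lam u) {m : ℕ}
    {B : Matrix (Fin N) (Fin N) ℝ} (hB : IsOptimalRankApprox A m B) :
    frobNorm (A - B) ≤ √(∑ i with m ≤ (i : Fin N).val, lam i ^ 2) := by
  classical
  set v : Fin N → ℝ := fun i => if (i : ℕ) < m then lam i else 0 with hv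
  refine (hB.2 (basisMatrix u * diagonal v * (basisMatrix u)ᵀ) ?_).trans_eq ?_
  · refine (rank_mul_le_left _ _).trans ((rank_mul_le_right _ _).trans ?_)
    rw [rank_diagonal]
    let f : {i : Fin N // v i ≠ 0} → Fin m := fun i => ⟨i.1, by
      by_contra hi
      exact i.2 (by simp [hv, hi])⟩
    have hf : Function.Injective f := fun i j hij => by
      rw [Fin.mk.injEq] at hij
      exact Subtype.ext (Fin.ext hij)
    simpa using Fintype.card_le_of_injective f hf
  · have hsub : A - basisMatrix u * diagonal v * (basisMatrix u)ᵀ =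
        basisMatrix u * diagonal (fun i => lam i - v i) * (basisMatrix u)ᵀ := by
      conv_lhs => rw [h.eq_mul_diagonal_mul]
      rw [← Matrix.sub_mul, ← Matrix.mul_sub, diagonal_sub]
    rw [hsub, frobNorm_mul_diagonal_mul_transpose, Finset.sum_filter]
    congr 1
    refine Finset.sum_congr rfl fun i _ => ?_
    by_cases hi : (i : ℕ) < m
    · simp [hv, hi, Nat.not_le.2 hi]
    · simp [hv, hi, Nat.le_of_not_lt hi]

/-- Since the eigenvalues decrease, those beyond the rank vanish. -/
theorem IsSpectralDecomposition.eq_zero_of_rank_le (h : IsSpectralDecomposition A lam u)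
    (h0 : ∀ i, 0 ≤ lam i) (i : Fin N) (hi : A.rank ≤ i) : lam i = 0 := by
  classical
  by_contra hne
  have hpos : 0 < lam i := lt_of_le_of_ne (h0 i) (Ne.symm hne)
  have hdet : ∀ {X Y : Matrix (Fin N) (Fin N) ℝ}, X * Y = 1 → IsUnit X.det := fun hXY =>
    (Matrix.isUnit_iff_isUnit_det _).1 (IsUnit.of_mul_eq_one _ hXY)
  have hrank : A.rank = Fintype.card {j // lam j ≠ 0} := by
    rw [h.eq_mul_diagonal_mul,
      rank_mul_eq_left_of_isUnit_det _ _ (hdet (basisMatrix_transpose_mul u)),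
      rank_mul_eq_right_of_isUnit_det _ _ (hdet (basisMatrix_mul_transpose u)), rank_diagonal]
  let f : Fin (i + 1) → {j // lam j ≠ 0} := fun j =>
    ⟨⟨j, by omega⟩, (hpos.trans_le (h.1 (Fin.le_def.2 (Nat.le_of_lt_succ j.2)))).ne'⟩
  have hf : Function.Injective f := fun j j' hjj => by
    have := congrArg (fun q : {j // lam j ≠ 0} => (q.1 : ℕ)) hjj
    exact Fin.ext this
  have := Fintype.card_le_of_injective f hf
  rw [Fintype.card_fin] at this
  omega

variable {E : Type*} [NormedAddCommGroup E] [InnerProductSpace ℝ E] {x : Fin N → E}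

/-- The eigenvalues of a Gram matrix are the squared lengths of the eigenvectors in feature
space. -/
theorem IsSpectralDecomposition.norm_sq_eq (h : IsSpectralDecomposition A lam u)
    (hx : ∀ n m, A n m = inner ℝ (x n) (x m)) (i : Fin N) :
    ‖∑ n, u i n • x n‖ ^ 2 = lam i := by
  have h1 : ∑ n, u i n * u i n = 1 := by
    have := congrFun (congrFun (basisMatrix_transpose_mul u) i) i
    simpa [Matrix.mul_apply, basisMatrix] using this
  have h2 : ∀ n, ∑ m, A n m * u i m = lam i * u i n := fun n => congrFun (h.2 i) n
  rw [← real_inner_self_eq_norm_sq, sum_inner]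
  simp_rw [inner_sum, real_inner_smul_left, real_inner_smul_right, ← hx]
  calc _ = ∑ n, u i n * ∑ m, A n m * u i m := by
        refine Finset.sum_congr rfl fun n _ => ?_
        rw [Finset.mul_sum]
        exact Finset.sum_congr rfl fun m _ => by ring
    _ = lam i * ∑ n, u i n * u i n := by
        rw [Finset.mul_sum]
        exact Finset.sum_congr rfl fun n _ => by rw [h2]; ring
    _ = lam i := by rw [h1, mul_one]

/-- Passing to the coordinates of an orthonormal basis preserves the sum of squared norms. -/
theorem sum_norm_sq_basis (u : OrthonormalBasis (Fin N) ℝ (EuclideanSpace ℝ (Fin N)))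
    (q : Fin N → E) : ∑ i, ‖∑ n, u i n • q n‖ ^ 2 = ∑ n, ‖q n‖ ^ 2 := by
  have h1 : ∀ n m, ∑ i, u i n * u i m = if n = m then 1 else 0 := fun n m => by
    have := congrFun (congrFun (basisMatrix_mul_transpose u) n) m
    simpa [Matrix.mul_apply, basisMatrix, Matrix.one_apply] using this
  simp_rw [← real_inner_self_eq_norm_sq, sum_inner, inner_sum, real_inner_smul_left,
    real_inner_smul_right, ← mul_assoc]
  rw [Finset.sum_comm]
  refine Finset.sum_congr rfl fun n _ => ?_
  rw [Finset.sum_comm]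
  simp_rw [← Finset.sum_mul, h1]
  simp

/-- The part of the points that is orthogonal to the top eigenvectors is controlled by the tail of
the eigenvalues. -/
theorem IsSpectralDecomposition.sum_norm_starProjection_orthogonal_sq_le [FiniteDimensional ℝ E]
    (h : IsSpectralDecomposition A lam u) (hx : ∀ n m, A n m = inner ℝ (x n) (x m)) (m : ℕ) :
    ∑ n, ‖(topSubspace x u m)ᗮ.starProjection (x n)‖ ^ 2 ≤
      ∑ i with m ≤ (i : Fin N).val, lam i := by
  rw [← sum_norm_sq_basis u, Finset.sum_filter]
  refine Finset.sum_le_sum fun i _ => ?_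
  have hmap : ∑ n, u i n • (topSubspace x u m)ᗮ.starProjection (x n) =
      (topSubspace x u m)ᗮ.starProjection (∑ n, u i n • x n) := by
    simp
  rw [hmap]
  split_ifs with hi
  · rw [← h.norm_sq_eq hx i]
    gcongr
    exact Submodule.norm_starProjection_apply_le _ _
  · have hmem : ∑ n, u i n • x n ∈ topSubspace x u m :=
      Submodule.subset_span ⟨i, by omega, rfl⟩
    rw [Submodule.starProjection_orthogonal_apply_eq_zero hmem]
    simp

end Spectral

/-- The clustering-potential condition bounds the whole potential: the part inside the top
eigenspace by assumption, the part orthogonal to it by the tail of the spectrum. -/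
theorem PotentialCondition.potential_le {d N k l m : ℕ} {y : Fin N → EuclideanSpace ℝ (Fin d)}
    {lam : Fin N → ℝ} {u : OrthonormalBasis (Fin N) ℝ (EuclideanSpace ℝ (Fin N))}
    {Hm : Matrix (Fin N) (Fin N) ℝ} {c : Fin N → Fin l} (hc : PotentialCondition k y m Hm u c)
    (hmN : m ≤ N) (h : IsSpectralDecomposition (gram k y) lam u)
    (hHm : IsOptimalRankApprox (gram k y) m Hm) :
    potential (fun n => feature k (y n)) c ≤
      2 * (√((N : ℝ) - m) * √(∑ i with m ≤ (i : Fin N).val, lam i ^ 2)) := by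
  have hx : ∀ n n', gram k y n n' = inner ℝ (feature k (y n)) (feature k (y n')) :=
    fun n n' => by rw [inner_feature]; rfl
  have h1 : ∑ i with m ≤ (i : Fin N).val, lam i ≤
      √((N : ℝ) - m) * √(∑ i with m ≤ (i : Fin N).val, lam i ^ 2) := by
    have hcard : ((Finset.univ.filter fun i : Fin N => m ≤ i.val).card : ℝ) = N - m := by
      rw [← Nat.cast_sub hmN]
      congr 1
      rw [Finset.card_filter, Fin.sum_univ_eq_sum_range (fun i => if m ≤ i then 1 else 0) N,
        ← Finset.card_filter, ← Nat.card_Ico]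
      congr 1
      ext i
      simp [and_comm]
    rw [← Real.sqrt_mul (by rw [← hcard]; positivity), ← hcard]
    exact Real.le_sqrt_of_sq_le sq_sum_le_card_mul_sum_sq
  rw [potential_eq_add_orthogonal _ c (topSubspace (fun n => feature k (y n)) u m)]
  have h2 := (potential_le_sum_norm_sq _ c).trans
    (h.sum_norm_starProjection_orthogonal_sq_le hx m)
  have h3 := hc.trans (mul_le_mul_of_nonneg_left (h.frobNorm_sub_le hHm) (Real.sqrt_nonneg _))
  rw [projectedPotential] at h3
  linarith

/-! ### Polynomial decay of the spectrum -/

/-- Comparison with `∫ t ^ (-2a)` over `[m, N]`; the factor `1 / (2a - 1) < 1` is dropped. -/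
theorem sum_rpow_neg_le {a : ℝ} (ha : 1 < a) {m N : ℕ} (hm : 1 ≤ m) (hmN : m ≤ N) :
    ∑ i ∈ Finset.Ico m N, (((i : ℝ) + 1) ^ (-a)) ^ 2 ≤ ((m : ℝ) ^ (-a + 1 / 2)) ^ 2 := by
  have hm0 : (0 : ℝ) < m := by exact_mod_cast hm
  have hmN' : (m : ℝ) ≤ N := by exact_mod_cast hmN
  have hanti : AntitoneOn (fun t : ℝ => t ^ (-a * 2)) (Set.Icc (m : ℝ) N) := by
    intro s hs t ht hst
    exact Real.rpow_le_rpow_of_nonpos (hm0.trans_le hs.1) hst (by linarith)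
  have h0 : (0 : ℝ) ∉ Set.uIcc (m : ℝ) N := by
    rw [Set.uIcc_of_le hmN']
    exact fun h => absurd h.1 (not_le.2 hm0)
  have hint := hanti.sum_le_integral_Ico hmN
  rw [integral_rpow (Or.inr ⟨by linarith, h0⟩)] at hint
  have hpow : ∀ t : ℝ, 0 ≤ t → ∀ b : ℝ, (t ^ b) ^ 2 = t ^ (b * 2) := fun t ht b => by
    rw [Real.rpow_mul ht, Real.rpow_two]
  calc ∑ i ∈ Finset.Ico m N, (((i : ℝ) + 1) ^ (-a)) ^ 2
      = ∑ i ∈ Finset.Ico m N, ((i + 1 : ℕ) : ℝ) ^ (-a * 2) :=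
        Finset.sum_congr rfl fun i _ => by rw [hpow _ (by positivity)]; push_cast; rfl
    _ ≤ _ := hint
    _ = ((m : ℝ) ^ (-a * 2 + 1) - (N : ℝ) ^ (-a * 2 + 1)) / (2 * a - 1) := by
        rw [← neg_div_neg_eq]; ring_nf
    _ ≤ (m : ℝ) ^ (-a * 2 + 1) := by
        have g1 : 0 ≤ (N : ℝ) ^ (-a * 2 + 1) := by positivity
        have g2 : 0 ≤ (m : ℝ) ^ (-a * 2 + 1) := by positivity
        rw [div_le_iff₀ (by linarith)]
        nlinarith
    _ = _ := by rw [hpow _ hm0.le]; ring_nf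

theorem sqrt_sum_sq_tail_le {a C : ℝ} (ha : 1 < a) (hC : 0 < C) {m N : ℕ} (hm : 1 ≤ m)
    (hmN : m ≤ N) {lam : Fin N → ℝ} (h0 : ∀ i, 0 ≤ lam i)
    (hlam : ∀ i : Fin N, m ≤ (i : ℕ) → lam i ≤ C * ((i : ℝ) + 1) ^ (-a)) :
    √(∑ i with m ≤ (i : Fin N).val, lam i ^ 2) ≤ C * (m : ℝ) ^ (-a + 1 / 2) := by
  refine Real.sqrt_le_iff.2 ⟨by positivity, ?_⟩
  calc ∑ i with m ≤ (i : Fin N).val, lam i ^ 2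
      ≤ ∑ i with m ≤ (i : Fin N).val, (C * ((i.val : ℝ) + 1) ^ (-a)) ^ 2 := by
        refine Finset.sum_le_sum fun i hi => ?_
        have := h0 i
        have := hlam i (Finset.mem_filter.1 hi).2
        gcongr
    _ = ∑ i ∈ Finset.Ico m N, (C * ((i : ℝ) + 1) ^ (-a)) ^ 2 := by
        rw [Finset.sum_filter, Fin.sum_univ_eq_sum_range
          (fun i => if m ≤ i then (C * ((i : ℝ) + 1) ^ (-a)) ^ 2 else 0) N, ← Finset.sum_filter]
        congr 1
        ext i
        simp [and_comm]
    _ = C ^ 2 * ∑ i ∈ Finset.Ico m N, (((i : ℝ) + 1) ^ (-a)) ^ 2 := by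
        rw [Finset.mul_sum]
        exact Finset.sum_congr rfl fun i _ => mul_pow ..
    _ ≤ C ^ 2 * ((m : ℝ) ^ (-a + 1 / 2)) ^ 2 := by
        gcongr
        exact sum_rpow_neg_le ha hm hmN
    _ = _ := (mul_pow ..).symm

/-- The constant comes from `1 + harmonic l ≤ 2 + log m` and `2 ≤ 3 * log 2`. -/
theorem one_add_harmonic_le {l m : ℕ} (hm : 2 ≤ m) (hl : l ≤ m) :
    1 + (harmonic l : ℝ) ≤ 4 * Real.log m := by
  have hlog : Real.log 2 ≤ Real.log m :=
    Real.log_le_log (by norm_num) (by exact_mod_cast hm)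
  have h2 := Real.log_two_gt_d9
  rcases Nat.eq_zero_or_pos l with rfl | hl0
  · simp
    linarith
  · have h1 := harmonic_le_one_add_log l
    have h3 : Real.log l ≤ Real.log m :=
      Real.log_le_log (by exact_mod_cast hl0) (by exact_mod_cast hl)
    linarith

end KernelNystrom

theorem mainTheorem8 :
    (∀ a C : ℝ, 1 < a → 0 < C → ∃ K : ℝ, 0 < K ∧
      ∀ (d N k m l i₀ : ℕ) [NeZero N] (y : Fin N → EuclideanSpace ℝ (Fin d))
        (lam : Fin N → ℝ) (u : OrthonormalBasis (Fin N) ℝ (EuclideanSpace ℝ (Fin N)))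
        (Hm : Matrix (Fin N) (Fin N) ℝ) (c : Fin N → Fin l),
        2 ≤ m → i₀ ≤ m → m ≤ N → (l = m ∨ l = m + 1) →
        KernelNystrom.IsSpectralDecomposition (KernelNystrom.gram k y) lam u →
        (∀ i : Fin N, i₀ ≤ (i : ℕ) + 1 → lam i ≤ C * ((i : ℝ) + 1) ^ (-a)) →
        KernelNystrom.IsOptimalRankApprox (KernelNystrom.gram k y) m Hm →
        KernelNystrom.IsOptimalClustering (fun n => KernelNystrom.feature k (y n)) c →
        KernelNystrom.PotentialCondition k y m Hm u c →
        KernelNystrom.expectedError k y l ≤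
          K * (Real.log m * √((N : ℝ) - m) * (m : ℝ) ^ (-a + 1 / 2))) ∧
    (∀ (d N k m l : ℕ) [NeZero N] (y : Fin N → EuclideanSpace ℝ (Fin d))
        (lam : Fin N → ℝ) (u : OrthonormalBasis (Fin N) ℝ (EuclideanSpace ℝ (Fin N)))
        (Hm : Matrix (Fin N) (Fin N) ℝ) (c : Fin N → Fin l),
        1 ≤ m → (KernelNystrom.gram k y).rank = m → (l = m ∨ l = m + 1) →
        KernelNystrom.IsSpectralDecomposition (KernelNystrom.gram k y) lam u →
        KernelNystrom.IsOptimalRankApprox (KernelNystrom.gram k y) m Hm →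
        KernelNystrom.IsOptimalClustering (fun n => KernelNystrom.feature k (y n)) c →
        KernelNystrom.PotentialCondition k y m Hm u c →
        KernelNystrom.expectedError k y l = 0) := by
  have hnonneg : ∀ {d N k : ℕ} {y : Fin N → EuclideanSpace ℝ (Fin d)} {lam : Fin N → ℝ}
      {u : OrthonormalBasis (Fin N) ℝ (EuclideanSpace ℝ (Fin N))},
      KernelNystrom.IsSpectralDecomposition (KernelNystrom.gram k y) lam u → ∀ i, 0 ≤ lam i :=
    fun {d N k y lam u} h i => by
      rw [← h.norm_sq_eq (x := fun n => KernelNystrom.feature k (y n))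
        (fun n m => by rw [KernelNystrom.inner_feature]; rfl) i]
      positivity
  -- `64 = 8 * 4 * 2`: k-means++, the harmonic number, and the two parts of the potential
  refine ⟨fun a C ha hC => ⟨64 * C, by positivity, ?_⟩, ?_⟩
  · intro d N k m l i₀ _ y lam u Hm c hm hi₀ hmN hl hspec hdecay hHm _ hcond
    have h1 := KernelNystrom.expectedError_le k y c
    have h2 := hcond.potential_le hmN hspec hHm
    have h3 := KernelNystrom.sqrt_sum_sq_tail_le ha hC (by omega) hmN (hnonneg hspec)
      (fun i hi => hdecay i (by omega))
    have h4 := KernelNystrom.one_add_harmonic_le hm (show l - 1 ≤ m by omega)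
    have hlog : 0 ≤ Real.log m := Real.log_natCast_nonneg m
    calc KernelNystrom.expectedError k y l
        ≤ 8 * (1 + (harmonic (l - 1) : ℝ)) *
          KernelNystrom.potential (fun n => KernelNystrom.feature k (y n)) c := h1
      _ ≤ 8 * (4 * Real.log m) * (2 * (√((N : ℝ) - m) * (C * (m : ℝ) ^ (-a + 1 / 2)))) := by
          refine mul_le_mul (by linarith) (h2.trans (by gcongr)) ?_ (by positivity)
          exact Finset.sum_nonneg fun n _ => sq_nonneg _
      _ = _ := by ring
  · intro d N k m l _ y lam u Hm c hm hrank hl hspec hHm _ hcond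
    have hmN : m ≤ N := by
      rw [← hrank]
      simpa using Matrix.rank_le_card_width (KernelNystrom.gram k y)
    have h1 := KernelNystrom.expectedError_le k y c
    have h2 := hcond.potential_le hmN hspec hHm
    have h3 : ∑ i with m ≤ (i : Fin N).val, lam i ^ 2 = 0 := by
      refine Finset.sum_eq_zero fun i hi => ?_
      rw [hspec.eq_zero_of_rank_le (hnonneg hspec) i (hrank.trans_le (Finset.mem_filter.1 hi).2)]
      norm_num
    rw [h3, Real.sqrt_zero, mul_zero, mul_zero] at h2
    refine le_antisymm (h1.trans ?_) ?_
    · exact mul_nonpos_of_nonneg_of_nonpos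
        (mul_nonneg (by norm_num) (by linarith [KernelNystrom.harmonic_nonneg (l - 1)])) h2
    · exact Finset.sum_nonneg fun z _ => mul_nonneg ENNReal.toReal_nonneg (Real.sqrt_nonneg _)
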